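/- An HRLQ instance is a finite bipartite graph $G=(\mathcal R\cup\mathcal H,E)$ of residents and hospitals in which every vertex has a strict preference order on its neighbours and every hospital $h$ has an upper quota $q^+(h)$ and a lower quota $q^-(h)$ with $0\le q^-(h)\le q^+(h)$. A matching is a set $M\subseteq E$ in which every resident lies in at most one edge and every hospital $h$ has at most $q^+(h)$ partners; it is feasible if moreover $|M(h)|\ge q^-(h)$ for all $h$, where $M(v)$ is the set of partners of $v$. **Votes.** Every vertex prefers each of its neighbours to $\bot$. For a vertex $u$ and $x,y\in N(u)\cup\{\bot\}$ let $vote_u(x,y)$ be $1$, $-1$, $0$ according as $u$ prefers $x$ to $y$, prefers $y$ to $x$, or $x=y$. For matchings $M_1,M_2$ put $vote_r(M_1,M_2)=vote_r(M_1(r),M_2(r))$ for a resident $r$ (with $M(r)=\bot$ if $r$ is unmatched). Each hospital $h$ chooses, for every ordered pair $(M_1,M_2)$, in an arbitrary way, a bijection between $M_1(h)\setminus M_2(h)$ and $M_2(h)\setminus M_1(h)$, after copies of $\bot$ have been added to the smaller of these two sets to make the sizes equal; $vote_h(M_1,M_2)$ is the sum of $vote_h(x,y)$ over the pairs $(x,y)$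 of this bijection, with $x$ from the first and $y$ from the second set. Let $\Delta(M_1,M_2)=\sum_{v\in\mathcal R\cup\mathcal H}vote_v(M_1,M_2)$. A feasible matching $M$ is popular in the set of feasible matchings if there is no feasible $N$ with $\Delta(N,M)>\Delta(M,N)$. **The instance $G'$.** Let $\ell=2+\sum_{h}q^-(h)$. The Hospital Residents instance $G'$ (without lower quotas) has hospitals $h^0,\dots,h^{\ell-1}$ for every $h\in\mathcal H$, where $h^s$ has capacity $q^+(h)$ if $s\le 1$ and $q^-(h)$ if $s\ge 2$. Its residents are those of $\mathcal R$ and, for every $h$ and $0\le s\le \ell-2$, dummy residents $d^s_{h,1},\dots,d^s_{h,k}$, where $k$ is the capacity of $h^s$; write $\mathcal D^s_h$ for the list of these by increasing index. A resident $r\in\mathcal R$ is adjacent to all copies of its neighbours in $G$; it prefers copies of higher level to copies of lower level, and ranks copies of the same level as in $G$. The dummy $d^s_{h,i}$ has the preference list $\langle h^s,h^{s+1}\rangle$, except that $d^1_{h,i}$ with $i\le q^+(h)-q^-(h)$ has the list $\langle h^1\rangle$. The preference list of $h^s$ consists of those members of $\mathcal D^{s-1}_h$ that are adjacent to it (none if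 $s=0$), followed by the preference list of $h$ in $G$, followed by $\mathcal D^s_h$ (none if $s=\ell-1$). A matching of $G'$ is stable if no edge $(r,h)$ of $G'$ blocks it, that is, if there is no edge $(r,h)$ such that $r$ is unmatched or prefers $h$ to its partner, and $h$ has a free position or prefers $r$ to one of its partners. **Claim.** Let $M'$ be any stable matching of $G'$, and let $M=map(M')$ be the matching of $G$ in which $r\in\mathcal R$ is matched to $h$ if and only if $M'$ matches $r$ to some copy $h^s$ of $h$. Then, for every choice of the hospitals' bijections: 1. for every feasible matching $N$ of $G$ with $|N|>|M|$, $\Delta(N,M)<\Delta(M,N)$; 2. if $G$ has a feasible matching, then $M$ is a maximum-cardinality matching among those popular in the set of feasible matchings: $M$ is feasible and popular in the set of feasible matchings, and $|N|\le|M|$ for every matching $N$ that is popular in the set of feasible matchings. -/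

import Mathlib

/-- A Hospital Residents instance: a bipartite graph on residents `R` and hospitals `H`, a strict
preference order of every vertex on its neighbours (`prefR r h h'` says that `r` prefers `h` to
`h'`; it is only meaningful on neighbours of `r`, and likewise for `prefH`), and a capacity for
every hospital. -/
structure HRInstance (R H : Type*) where
  adj : R → H → Prop
  prefR : R → H → H → Prop
  prefH : H → R → R → Prop
  cap : H → ℕ
  prefR_irrefl : ∀ r h, adj r h → ¬ prefR r h h
  prefR_trans : ∀ r h₁ h₂ h₃, adj r h₁ → adj r h₂ → adj r h₃ →
    prefR r h₁ h₂ → prefR r h₂ h₃ → prefR r h₁ h₃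
  prefR_total : ∀ r h₁ h₂, adj r h₁ → adj r h₂ → h₁ ≠ h₂ → prefR r h₁ h₂ ∨ prefR r h₂ h₁
  prefH_irrefl : ∀ h r, adj r h → ¬ prefH h r r
  prefH_trans : ∀ h r₁ r₂ r₃, adj r₁ h → adj r₂ h → adj r₃ h →
    prefH h r₁ r₂ → prefH h r₂ r₃ → prefH h r₁ r₃
  prefH_total : ∀ h r₁ r₂, adj r₁ h → adj r₂ h → r₁ ≠ r₂ → prefH h r₁ r₂ ∨ prefH h r₂ r₁

/-- A Hospital Residents instance with lower quotas; `cap h` is the upper quota `q⁺(h)` and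
`lower h` is the lower quota `q⁻(h)`. -/
structure HRLQInstance (R H : Type*) extends HRInstance R H where
  lower : H → ℕ
  lower_le_cap : ∀ h, lower h ≤ cap h

/-- An assignment of residents to hospitals, `none` meaning unmatched. As a set of pairs it is
`{(r, h) | M r = some h}`, so every resident lies in at most one pair. -/
abbrev Assignment (R H : Type*) := R → Option H

open Classical in
/-- `M(h)`: the residents that `M` assigns to `h`. -/
noncomputable def Assignment.residents {R H : Type*} [Fintype R] (M : Assignment R H) (h : H) :
    Finset R :=
  Finset.univ.filter fun r => M r = some h

open Classical in
/-- `|M|`: the number of matched pairs. -/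
noncomputable def Assignment.size {R H : Type*} [Fintype R] (M : Assignment R H) : ℕ :=
  (Finset.univ.filter fun r => M r ≠ none).card

/-- The preference of a vertex extended to `N(u) ∪ {⊥}`: every neighbour is preferred to `⊥`. -/
def optPref {α : Type*} (pref : α → α → Prop) : Option α → Option α → Prop
  | some x, some y => pref x y
  | some _, none => True
  | none, _ => False

namespace HRInstance

variable {R H : Type*}

/-- `M` only uses edges of the graph and respects all the capacities. -/
def IsMatching [Fintype R] (G : HRInstance R H) (M : Assignment R H) : Prop :=
  (∀ r h, M r = some h → G.adj r h) ∧ ∀ h, (M.residents h).card ≤ G.cap h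

/-- The edge `(r, h)` blocks `M`. -/
def Blocks [Fintype R] (G : HRInstance R H) (M : Assignment R H) (r : R) (h : H) : Prop :=
  G.adj r h ∧ optPref (G.prefR r) (some h) (M r) ∧
    ((M.residents h).card < G.cap h ∨ ∃ r' ∈ M.residents h, G.prefH h r r')

/-- `M` is a stable matching. -/
def IsStable [Fintype R] (G : HRInstance R H) (M : Assignment R H) : Prop :=
  G.IsMatching M ∧ ∀ r h, ¬ G.Blocks M r h

end HRInstance

/-! ### Votes and popularity -/

open Classical in
/-- `vote_u(x, y)` for a vertex `u` with preference relation `pref`. -/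
noncomputable def vote {α : Type*} (pref : α → α → Prop) (x y : Option α) : ℤ :=
  if optPref pref x y then 1 else if optPref pref y x then -1 else 0

/-- A pairing of the elements of two finite sets `A` and `B`, the smaller of which is filled up
with copies of `⊥` to the size of the larger one. For `r ∈ A`, `corr r` is the element of
`B ∪ {⊥}` that corresponds to `r`; the elements of `B` that correspond to no element of `A`
are paired with `⊥`. Since `⊥` is added on one side only, an element of `A` is paired with `⊥`
only if every element of `B` is paired with an element of `A`. -/
structure Pairing {R : Type*} (A B : Finset R) where
  corr : R → Option R
  corr_mem : ∀ r ∈ A, ∀ r', corr r = some r' → r' ∈ B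
  corr_inj : ∀ r₁ ∈ A, ∀ r₂ ∈ A, ∀ r', corr r₁ = some r' → corr r₂ = some r' → r₁ = r₂
  corr_max : ∀ r ∈ A, corr r = none → ∀ r' ∈ B, ∃ r₀ ∈ A, corr r₀ = some r'

open Classical in
/-- For every hospital `h` and every two assignments `M₁`, `M₂`, a pairing `corr_h(·, M₁, M₂)` of
`M₁(h) \ M₂(h)` with `M₂(h) \ M₁(h)`, chosen by the hospital in an arbitrary way. -/
abbrev VotingRule (R H : Type*) [Fintype R] :=
  ∀ (h : H) (M₁ M₂ : Assignment R H),
    Pairing (M₁.residents h \ M₂.residents h) (M₂.residents h \ M₁.residents h)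

open Classical in
/-- The sum of `vote(x, y)` over all pairs `(x, y)` of a pairing, including those where one of
`x`, `y` is `⊥`. -/
noncomputable def Pairing.votes {R : Type*} {A B : Finset R} (c : Pairing A B)
    (pref : R → R → Prop) : ℤ :=
  (∑ r ∈ A, vote pref (some r) (c.corr r)) +
    ∑ r' ∈ B.filter (fun r' => ∀ r ∈ A, c.corr r ≠ some r'), vote pref none (some r')

namespace HRLQInstance

variable {R H : Type*}

/-- `Δ(M₁, M₂)`: the sum of `vote_v(M₁, M₂)` over all residents and hospitals `v`. -/
noncomputable def Delta [Fintype R] [Fintype H] (G : HRLQInstance R H) (c : VotingRule R H)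
    (M₁ M₂ : Assignment R H) : ℤ :=
  (∑ r, vote (G.prefR r) (M₁ r) (M₂ r)) + ∑ h, (c h M₁ M₂).votes (G.prefH h)

/-- Feasible matchings respect upper and lower quotas. -/
def IsFeasible [Fintype R] (G : HRLQInstance R H) (M : Assignment R H) : Prop :=
  G.toHRInstance.IsMatching M ∧ ∀ h, G.lower h ≤ (M.residents h).card

/-- `M₁ ≻ M₂`: the assignment `M₁` is more popular than `M₂`. -/
def MorePopular [Fintype R] [Fintype H] (G : HRLQInstance R H) (c : VotingRule R H)
    (M₁ M₂ : Assignment R H) : Prop :=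
  G.Delta c M₂ M₁ < G.Delta c M₁ M₂

/-- `M` is popular in the set of feasible matchings. -/
def IsPopularFeasible [Fintype R] [Fintype H] (G : HRLQInstance R H) (c : VotingRule R H)
    (M : Assignment R H) : Prop :=
  G.IsFeasible M ∧ ∀ N, G.IsFeasible N → ¬ G.MorePopular c N M

/-! ### The Hospital Residents instance `G'` -/

/-- The number `ℓ` of levels. -/
def numLevels [Fintype H] (G : HRLQInstance R H) : ℕ := 2 + ∑ h, G.lower h

/-- The capacity of the level-`s` copy of `h`, which is also the number of level-`s` dummy
residents of `h` (for `s ≤ ℓ - 2`). -/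
def levelCap (G : HRLQInstance R H) (h : H) (s : ℕ) : ℕ :=
  if s ≤ 1 then G.cap h else G.lower h

/-- The hospitals of `G'`: `(h, s)` is the level-`s` copy of `h`, for `0 ≤ s ≤ ℓ - 1`. -/
abbrev CopyHosp [Fintype H] (G : HRLQInstance R H) := H × Fin G.numLevels

/-- The dummy residents of `G'`: `⟨h, s, i⟩` is the dummy resident `d^s_{h,i+1}`, where
`0 ≤ s ≤ ℓ - 2`; the indices `i` start at `0` here. -/
abbrev Dummy [Fintype H] (G : HRLQInstance R H) :=
  Σ (h : H) (s : Fin (G.numLevels - 1)), Fin (G.levelCap h s)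

/-- The residents of `G'`. -/
abbrev AllRes [Fintype H] (G : HRLQInstance R H) := R ⊕ G.Dummy

/-- The edges of `G'`. A resident of `G` is adjacent to all copies of its neighbours. A level-`s`
dummy resident of `h` is adjacent to `h^s` and to `h^{s+1}`, but for `s = 1` only the last
`q⁻(h)` of the `q⁺(h)` dummy residents are adjacent to `h^2`. -/
def redAdj [Fintype H] (G : HRLQInstance R H) : G.AllRes → G.CopyHosp → Prop
  | Sum.inl r, (h, _) => G.adj r h
  | Sum.inr ⟨h, s, i⟩, (h', t) => h = h' ∧
      (t.val = s.val ∨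
        (t.val = s.val + 1 ∧ (s.val = 1 → G.cap h - G.lower h ≤ i.val)))

/-- Preferences of the residents of `G'`: a resident of `G` prefers copies of higher level, and
copies of the same level are ordered as in `G`; dummy residents prefer the copy of lower level. -/
def redPrefR [Fintype H] (G : HRLQInstance R H) : G.AllRes → G.CopyHosp → G.CopyHosp → Prop
  | Sum.inl r, (h, s), (h', s') => s' < s ∨ (s = s' ∧ G.prefR r h h')
  | Sum.inr _, (_, s), (_, s') => s < s'

/-- Preferences of the hospitals of `G'`: the list of `h^s` consists of its dummy residents of
level `s - 1`, followed by the list of `h` in `G`, followed by its dummy residents of level `s`;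
dummy residents of the same level are ordered by their indices. -/
def redPrefH [Fintype H] (G : HRLQInstance R H) : G.CopyHosp → G.AllRes → G.AllRes → Prop
  | (h, _), Sum.inl r, Sum.inl r' => G.prefH h r r'
  | (_, s), Sum.inl _, Sum.inr ⟨_, t, _⟩ => s.val ≤ t.val
  | (_, s), Sum.inr ⟨_, t, _⟩, Sum.inl _ => t.val < s.val
  | _, Sum.inr ⟨_, t, i⟩, Sum.inr ⟨_, t', i'⟩ =>
      t.val < t'.val ∨ (t.val = t'.val ∧ i.val < i'.val)

/-- The instance `G'`. -/
def reduction [Fintype H] (G : HRLQInstance R H) : HRInstance G.AllRes G.CopyHosp where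
  adj := G.redAdj
  prefR := G.redPrefR
  prefH := G.redPrefH
  cap := fun p => G.levelCap p.1 p.2
  prefR_irrefl := by
    rintro (r | d) ⟨h, s⟩ ha hp
    · exact G.prefR_irrefl r h ha (by simpa [redPrefR] using hp)
    · simp [redPrefR] at hp
  prefR_trans := by
    rintro (r | d) ⟨h₁, s₁⟩ ⟨h₂, s₂⟩ ⟨h₃, s₃⟩ a₁ a₂ a₃ p q
    · simp only [redPrefR, redAdj] at *
      rcases p with p | ⟨rfl, p⟩ <;> rcases q with q | ⟨rfl, q⟩
      · exact Or.inl (q.trans p)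
      · exact Or.inl p
      · exact Or.inl q
      · exact Or.inr ⟨rfl, G.prefR_trans r _ _ _ a₁ a₂ a₃ p q⟩
    · simp only [redPrefR] at *
      exact p.trans q
  prefR_total := by
    rintro (r | ⟨h, s, i⟩) ⟨h₁, s₁⟩ ⟨h₂, s₂⟩ a₁ a₂ hne
    · simp only [redPrefR, redAdj] at *
      rcases lt_trichotomy s₁ s₂ with hs | rfl | hs
      · exact Or.inr (Or.inl hs)
      · rcases G.prefR_total r h₁ h₂ a₁ a₂ (by rintro rfl; exact hne rfl) with p | p
        · exact Or.inl (Or.inr ⟨rfl, p⟩)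
        · exact Or.inr (Or.inr ⟨rfl, p⟩)
      · exact Or.inl (Or.inl hs)
    · simp only [redPrefR, redAdj] at *
      obtain ⟨rfl, -⟩ := a₁
      obtain ⟨rfl, -⟩ := a₂
      exact lt_or_gt_of_ne (by rintro rfl; exact hne rfl)
  prefH_irrefl := by
    rintro ⟨h, s⟩ (r | ⟨h', t, i⟩) ha hp
    · exact G.prefH_irrefl h r ha hp
    · simp [redPrefH] at hp
  prefH_trans := by
    rintro ⟨h, s⟩ (r₁ | ⟨h₁, t₁, i₁⟩) (r₂ | ⟨h₂, t₂, i₂⟩) (r₃ | ⟨h₃, t₃, i₃⟩) a₁ a₂ a₃ p q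
    · exact G.prefH_trans h r₁ r₂ r₃ a₁ a₂ a₃ p q
    all_goals
      simp only [redPrefH] at *
      omega
  prefH_total := by
    rintro ⟨h, s⟩ (r₁ | ⟨h₁, t₁, i₁⟩) (r₂ | ⟨h₂, t₂, i₂⟩) a₁ a₂ hne
    · exact G.prefH_total h r₁ r₂ a₁ a₂ (by rintro rfl; exact hne rfl)
    · exact le_or_gt _ _
    · exact lt_or_ge _ _
    · simp only [redPrefH, redAdj] at *
      obtain ⟨rfl, -⟩ := a₁
      obtain ⟨rfl, -⟩ := a₂
      by_cases ht : t₁ = t₂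
      · subst ht
        have hi : i₁.val ≠ i₂.val := fun hi => hne (by rw [Fin.ext hi])
        omega
      · have ht' : t₁.val ≠ t₂.val := fun h' => ht (Fin.ext h')
        omega

/-- `map(M')`: the resident `r` is matched to `h` iff `M'` matches `r` to some copy of `h`. -/
def mapMatching [Fintype H] (G : HRLQInstance R H) (M' : Assignment G.AllRes G.CopyHosp) :
    Assignment R H :=
  fun r => (M' (Sum.inl r)).map Prod.fst

end HRLQInstance

/-!
The proof exhibits a dual certificate. Let `M'` be stable in `G'`, `M = map(M')`, and let `level r`
be the level of the copy that holds `r` (`0` for an unmatched `r`).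

*Structure of `M'`.* A copy `h^s` that has a free position or holds a dummy resident of its own
level would accept any further neighbour of `h`, so by stability every neighbour of `h` is matched
on level `s` or higher, and a neighbour held on level `s` by another hospital prefers that
hospital to `h` (`IsOpen.level_ge`). If `h^{s+1}` holds a resident of `G`, then some dummy resident
of level `s` has not risen to it and `h^s` is open (`isOpen_of_sitsAt_succ`). Following the dummy
residents from level to level shows that `h` has at most `q⁺(h)` residents in `M`, that it has at
most `q⁻(h)` of them as soon as one is on a level above `1` (`card_le_lower`), that `h^1` is open if
`h` is below its upper quota (`isOpen_one`), and that the top copy is open if `h` is below its lower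
quota (`isOpen_top`).

*Feasibility* (`isFeasible_mapMatching`). If some hospital misses its lower quota, fewer than
`∑ q⁻(h)` residents have level at least `2`, so one of the `∑ q⁻(h)` levels from `2` upwards is
empty. The deficient hospitals and those with residents above the empty level have all their
neighbours above it, and these are too few to fill the lower quotas.

*Popularity*. Give `r` the potential `2 * level r - 1`. When a hospital exchanges `y ∈ M(h)` for
`x ∈ N(h)`, the votes of `x` and of `h` sum to at most the potential of `x` minus that of `y`
(`vote_add_vote_le`); the analogous bounds hold for pairs with `⊥`, which is where the quota facts
enter (`gained_bound`, `lost_bound`). Since the bounds do not depend on the pairing, they control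
both `Δ(N, M)` and `-Δ(M, N)`, for which the hospitals may pair differently. Summed over all
vertices the potentials cancel, and what remains is at most minus the number of residents matched
by `N` but not by `M` (`sum_bound_le`), and there is such a resident if `|N| > |M|`.
-/

/-! ### Positions in the reduced instance -/

theorem Assignment.mem_residents {R H : Type*} [Fintype R] {N : Assignment R H} {h : H} {r : R} :
    r ∈ N.residents h ↔ N r = some h := by
  simp [Assignment.residents]

namespace HRLQInstance

section Levels

open Classical

variable {R H : Type*} [Fintype H] {G : HRLQInstance R H}
  {M' : Assignment G.AllRes G.CopyHosp}

/-- `M'` assigns `x` to the level-`s` copy of `h`; the level is a natural number, to spare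
arithmetic in `Fin`. -/
def SitsAt (M' : Assignment G.AllRes G.CopyHosp) (x : G.AllRes) (h : H) (s : ℕ) : Prop :=
  ∃ hs : s < G.numLevels, M' x = some (h, ⟨s, hs⟩)

/-- The dummy resident is adjacent to the copy one level above its own. -/
def Upward (d : G.Dummy) : Prop := d.2.1.val = 1 → G.cap d.1 - G.lower d.1 ≤ d.2.2.val

/-- The residents of `G` that `M'` assigns to `h^s`. -/
noncomputable def realAt [Fintype R] (M' : Assignment G.AllRes G.CopyHosp) (h : H) (s : ℕ) :
    Finset R :=
  Finset.univ.filter fun r => SitsAt M' (Sum.inl r) h s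

/-- The level-`s` dummy residents of `h` that `M'` assigns to `h^s`. -/
noncomputable def ownDummies (M' : Assignment G.AllRes G.CopyHosp) (h : H) (s : ℕ) :
    Finset G.Dummy :=
  Finset.univ.filter fun d => (d.1 = h ∧ d.2.1.val = s) ∧ SitsAt M' (Sum.inr d) h s

/-- The level-`s` dummy residents of `h` that could move up to `h^{s+1}` but are assigned
to `h^s`. -/
noncomputable def stayingDummies (M' : Assignment G.AllRes G.CopyHosp) (h : H) (s : ℕ) :
    Finset G.Dummy :=
  Finset.univ.filter fun d => ((d.1 = h ∧ d.2.1.val = s) ∧ Upward d) ∧ SitsAt M' (Sum.inr d) h s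

/-- The level-`s` dummy residents of `h` that are assigned to `h^{s+1}`. -/
noncomputable def risenDummies (M' : Assignment G.AllRes G.CopyHosp) (h : H) (s : ℕ) :
    Finset G.Dummy :=
  Finset.univ.filter fun d =>
    ((d.1 = h ∧ d.2.1.val = s) ∧ Upward d) ∧ SitsAt M' (Sum.inr d) h (s + 1)

theorem SitsAt.unique {x : G.AllRes} {h h' : H} {s t : ℕ} (a : SitsAt M' x h s)
    (b : SitsAt M' x h' t) : h = h' ∧ s = t := by
  obtain ⟨_, a⟩ := a
  obtain ⟨_, b⟩ := b
  rw [a] at b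
  simpa using b

theorem sitsAt_cases (M' : Assignment G.AllRes G.CopyHosp) (x : G.AllRes) :
    M' x = none ∨ ∃ h s, SitsAt M' x h s := by
  rcases hx : M' x with _ | ⟨h, s⟩
  · exact Or.inl rfl
  · exact Or.inr ⟨h, s.val, s.isLt, hx⟩

theorem card_dummies_filter (h : H) {s : ℕ} (hs : s < G.numLevels - 1) (Q : G.Dummy → Prop) :
    (Finset.univ.filter fun d : G.Dummy => (d.1 = h ∧ d.2.1.val = s) ∧ Q d).card =
      (Finset.univ.filter fun i : Fin (G.levelCap h s) => Q ⟨h, ⟨s, hs⟩, i⟩).card := by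
  symm
  refine Finset.card_bij (fun i _ => ⟨h, ⟨s, hs⟩, i⟩) ?_ ?_ ?_
  · intro i hi
    simpa using hi
  · intro i _ j _ hij
    simpa using hij
  · rintro ⟨h', ⟨t, ht⟩, i⟩ hd
    simp only [Finset.mem_filter, Finset.mem_univ, true_and] at hd
    obtain ⟨⟨rfl, rfl⟩, hq⟩ := hd
    exact ⟨i, by simpa using hq, rfl⟩

theorem card_dummies (h : H) {s : ℕ} (hs : s < G.numLevels - 1) :
    (Finset.univ.filter fun d : G.Dummy => d.1 = h ∧ d.2.1.val = s).card = G.levelCap h s := by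
  simpa using card_dummies_filter (G := G) h hs fun _ => True

/-- The dummy residents adjacent to `h^{s+1}` from below are as many as its positions. -/
theorem card_upward (h : H) {s : ℕ} (hs : s < G.numLevels - 1) :
    (Finset.univ.filter fun d : G.Dummy => (d.1 = h ∧ d.2.1.val = s) ∧ Upward d).card =
      G.levelCap h (s + 1) := by
  rw [card_dummies_filter h hs]
  have hle := G.lower_le_cap h
  by_cases h1 : s = 1
  · subst h1
    have e1 := Finset.card_filter_add_card_filter_not
      (s := (Finset.univ : Finset (Fin (G.levelCap h 1))))
      (fun i => i.val < G.cap h - G.lower h)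
    simp only [Finset.card_univ, Fintype.card_fin, Fin.card_filter_val_lt, not_lt] at e1
    simp only [Upward, forall_const]
    simp only [levelCap] at *
    simp at *
    omega
  · rcases Nat.lt_or_ge s 1 with h0 | h2
    · obtain rfl : s = 0 := by omega
      rw [Finset.filter_true_of_mem fun i _ h1 => absurd h1 (by simp), Finset.card_univ,
        Fintype.card_fin]
      rfl
    · rw [Finset.filter_true_of_mem fun i _ h2 => absurd h2 h1, Finset.card_univ,
        Fintype.card_fin, levelCap, levelCap, if_neg (by omega), if_neg (by omega)]

theorem card_low (h : H) :
    (Finset.univ.filter fun d : G.Dummy => (d.1 = h ∧ d.2.1.val = 1) ∧ ¬ Upward d).card ≤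
      G.cap h - G.lower h := by
  by_cases hs : 1 < G.numLevels - 1
  · have e1 := Finset.card_filter_add_card_filter_not
      (s := Finset.univ.filter fun d : G.Dummy => d.1 = h ∧ d.2.1.val = 1) Upward
    rw [Finset.filter_filter, Finset.filter_filter, card_upward h hs, card_dummies h hs] at e1
    simp only [levelCap] at e1
    simp at e1
    have hle := G.lower_le_cap h
    omega
  · rw [Finset.card_eq_zero.2]
    · exact Nat.zero_le _
    · refine Finset.filter_eq_empty_iff.2 fun d _ hd => hs ?_
      have := d.2.1.isLt
      omega

variable [Fintype R]

/-- `h^s` exists and has a free position. -/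
def HasRoom (M' : Assignment G.AllRes G.CopyHosp) (h : H) (s : ℕ) : Prop :=
  ∃ hs : s < G.numLevels, (M'.residents (h, ⟨s, hs⟩)).card < G.levelCap h s

/-- `h^s` would accept any further neighbour of `h`: it has a free position or is assigned a dummy
resident of its own level, which it ranks below all residents of `G`. -/
def IsOpen (M' : Assignment G.AllRes G.CopyHosp) (h : H) (s : ℕ) : Prop :=
  HasRoom M' h s ∨ (ownDummies M' h s).Nonempty

theorem mem_residents_iff {x : G.AllRes} {h : H} {s : ℕ} (hs : s < G.numLevels) :
    x ∈ M'.residents (h, ⟨s, hs⟩) ↔ SitsAt M' x h s := by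
  simp [Assignment.residents, SitsAt, hs]

theorem SitsAt.adj (hM' : G.reduction.IsStable M') {r : R} {h : H} {s : ℕ}
    (a : SitsAt M' (Sum.inl r) h s) : G.adj r h := by
  obtain ⟨hs, a⟩ := a
  exact hM'.1.1 _ _ a

theorem SitsAt.dummy (hM' : G.reduction.IsStable M') {d : G.Dummy} {h : H} {s : ℕ}
    (a : SitsAt M' (Sum.inr d) h s) :
    d.1 = h ∧ (s = d.2.1.val ∨ (s = d.2.1.val + 1 ∧ Upward d)) := by
  obtain ⟨hs, a⟩ := a
  exact hM'.1.1 _ _ a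

/-- A neighbour of `h` does not want to move to an open copy `h^s`. -/
theorem IsOpen.level_ge (hM' : G.reduction.IsStable M') {h : H} {s : ℕ} (ho : IsOpen M' h s)
    {r : R} (hr : G.adj r h) :
    ∃ h' t, SitsAt M' (Sum.inl r) h' t ∧ (s < t ∨ (s = t ∧ (h' = h ∨ G.prefR r h' h))) := by
  have hs : s < G.numLevels := by
    rcases ho with ⟨hs, _⟩ | ⟨d, hd⟩
    · exact hs
    · simp only [ownDummies, Finset.mem_filter] at hd
      exact hd.2.2.1
  have hb := hM'.2 (Sum.inl r) (h, ⟨s, hs⟩)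
  have hacc : (M'.residents (h, ⟨s, hs⟩)).card < G.reduction.cap (h, ⟨s, hs⟩) ∨
      ∃ r' ∈ M'.residents (h, ⟨s, hs⟩), G.reduction.prefH (h, ⟨s, hs⟩) (Sum.inl r) r' := by
    rcases ho with ⟨_, ho⟩ | ⟨d, hd⟩
    · exact Or.inl ho
    · simp only [ownDummies, Finset.mem_filter] at hd
      exact Or.inr ⟨Sum.inr d, (mem_residents_iff hs).2 hd.2.2, hd.2.1.2.ge⟩
  have hno : ¬ optPref (G.reduction.prefR (Sum.inl r)) (some (h, ⟨s, hs⟩)) (M' (Sum.inl r)) :=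
    fun hp => hb ⟨hr, hp, hacc⟩
  rcases hx : M' (Sum.inl r) with _ | ⟨h', t⟩
  · exact absurd (by rw [hx]; trivial) hno
  · refine ⟨h', t.val, ⟨t.isLt, hx⟩, ?_⟩
    rw [hx] at hno
    have hno' : ¬ (t < ⟨s, hs⟩ ∨ ((⟨s, hs⟩ : Fin G.numLevels) = t ∧ G.prefR r h h')) := hno
    have hadj : G.adj r h' := hM'.1.1 _ _ hx
    rcases lt_trichotomy s t.val with hlt | heq | hgt
    · exact Or.inl hlt
    · refine Or.inr ⟨heq, ?_⟩
      by_contra hc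
      push Not at hc
      rcases G.prefR_total r h h' hr hadj (fun e => hc.1 e.symm) with hp | hp
      · exact hno' (Or.inr ⟨Fin.ext heq, hp⟩)
      · exact hc.2 hp
    · exact absurd (Or.inl hgt) hno'

/-- A copy that misses a dummy resident of its own level is full, and the dummy residents of that
level that it holds have smaller indices, since the missing one would block otherwise. -/
theorem dummy_not_accepted (hM' : G.reduction.IsStable M') {d : G.Dummy} {s : ℕ}
    (hs : s < G.numLevels) (hsd : s = d.2.1.val) (hd : ¬ SitsAt M' (Sum.inr d) d.1 s) :
    (M'.residents (d.1, ⟨s, hs⟩)).card = G.levelCap d.1 s ∧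
      ∀ d' : G.Dummy, SitsAt M' (Sum.inr d') d.1 s → d'.2.1.val = s → d'.2.2.val ≤ d.2.2.val := by
  have hb := hM'.2 (Sum.inr d) (d.1, ⟨s, hs⟩)
  have hadj : G.reduction.adj (Sum.inr d) (d.1, ⟨s, hs⟩) := ⟨rfl, Or.inl hsd⟩
  have hp : optPref (G.reduction.prefR (Sum.inr d)) (some (d.1, ⟨s, hs⟩)) (M' (Sum.inr d)) := by
    rcases hx : M' (Sum.inr d) with _ | ⟨h', t⟩
    · trivial
    · have h2 := SitsAt.dummy hM' (d := d) ⟨t.isLt, hx⟩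
      rcases h2 with ⟨rfl, h2 | h2⟩
      · exact absurd ⟨hs, by
          rw [hx]; exact congrArg (fun u => some (d.1, u)) (Fin.ext (h2.trans hsd.symm))⟩ hd
      · change s < t.val
        exact hsd ▸ h2.1 ▸ Nat.lt_succ_self _
  constructor
  · refine le_antisymm (hM'.1.2 _) (not_lt.1 fun hlt => hb ⟨hadj, hp, Or.inl hlt⟩)
  · intro d' hd' hl
    by_contra hlt
    push Not at hlt
    exact hb ⟨hadj, hp, Or.inr ⟨Sum.inr d', (mem_residents_iff hs).2 hd',
      Or.inr ⟨hsd.symm.trans hl.symm, hlt⟩⟩⟩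

end Levels

end HRLQInstance

/-! ### Counting the dummy residents of a hospital -/

namespace HRLQInstance

section Counting

open Classical

variable {R H : Type*} [Fintype H] [Fintype R] {G : HRLQInstance R H}
  {M' : Assignment G.AllRes G.CopyHosp}

theorem card_residents_zero (hM' : G.reduction.IsStable M') (h : H) (hs : 0 < G.numLevels) :
    (M'.residents (h, ⟨0, hs⟩)).card = (realAt M' h 0).card + (ownDummies M' h 0).card := by
  have e : M'.residents (h, ⟨0, hs⟩) = (realAt M' h 0).disjSum (ownDummies M' h 0) := by
    ext x
    rw [mem_residents_iff]
    rcases x with r | d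
    · simp [realAt]
    · simp only [Finset.inr_mem_disjSum, ownDummies, Finset.mem_filter, Finset.mem_univ, true_and]
      refine ⟨fun hx => ⟨⟨(hx.dummy hM').1, ?_⟩, hx⟩, fun hx => hx.2⟩
      have := (hx.dummy hM').2
      omega
  rw [e, Finset.card_disjSum]

theorem card_residents_succ (hM' : G.reduction.IsStable M') (h : H) {s : ℕ}
    (hs : s + 1 < G.numLevels) :
    (M'.residents (h, ⟨s + 1, hs⟩)).card =
      (realAt M' h (s + 1)).card + ((ownDummies M' h (s + 1)).card +
        (risenDummies M' h s).card) := by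
  have hd : Disjoint (ownDummies M' h (s + 1)) (risenDummies M' h s) := by
    refine Finset.disjoint_left.2 fun d h1 h2 => ?_
    simp only [ownDummies, risenDummies, Finset.mem_filter] at h1 h2
    have := h1.2.1.2.symm.trans h2.2.1.1.2
    omega
  have e : M'.residents (h, ⟨s + 1, hs⟩) =
      (realAt M' h (s + 1)).disjSum ((ownDummies M' h (s + 1)).disjUnion
        (risenDummies M' h s) hd) := by
    ext x
    rw [mem_residents_iff]
    rcases x with r | d
    · simp [realAt]
    · simp only [Finset.inr_mem_disjSum, Finset.mem_disjUnion, ownDummies, risenDummies,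
        Finset.mem_filter, Finset.mem_univ, true_and]
      constructor
      · intro hx
        obtain ⟨e, h1 | ⟨h1, h2⟩⟩ := hx.dummy hM'
        · exact Or.inl ⟨⟨e, h1.symm⟩, hx⟩
        · exact Or.inr ⟨⟨⟨e, (Nat.succ_injective h1).symm⟩, h2⟩, hx⟩
      · rintro (hx | hx)
        · exact hx.2
        · exact hx.2
  rw [e, Finset.card_disjSum, Finset.card_disjUnion]

/-- An upward dummy resident is always assigned: if it were not, `h^{s+1}` would be filled with
the other dummy residents of its kind, and there are not enough of them. -/
theorem upward_sits (hM' : G.reduction.IsStable M') {d : G.Dummy} (hu : Upward d) :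
    SitsAt M' (Sum.inr d) d.1 d.2.1.val ∨ SitsAt M' (Sum.inr d) d.1 (d.2.1.val + 1) := by
  rcases sitsAt_cases M' (Sum.inr d) with hn | ⟨h, t, ht⟩
  · exfalso
    have hlt := d.2.1.isLt
    have hs : d.2.1.val + 1 < G.numLevels := by omega
    have hadj : G.reduction.adj (Sum.inr d) (d.1, ⟨d.2.1.val + 1, hs⟩) := ⟨rfl, Or.inr ⟨rfl, hu⟩⟩
    have hb := hM'.2 (Sum.inr d) (d.1, ⟨d.2.1.val + 1, hs⟩)
    have hp : optPref (G.reduction.prefR (Sum.inr d)) (some (d.1, ⟨d.2.1.val + 1, hs⟩))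
        (M' (Sum.inr d)) := by rw [hn]; trivial
    have hworse : ∀ x ∈ M'.residents (d.1, ⟨d.2.1.val + 1, hs⟩),
        ¬ G.reduction.prefH (d.1, ⟨d.2.1.val + 1, hs⟩) (Sum.inr d) x :=
      fun x hx hpx => hb ⟨hadj, hp, Or.inr ⟨x, hx, hpx⟩⟩
    have hreal : (realAt M' d.1 (d.2.1.val + 1)).card = 0 := by
      rw [Finset.card_eq_zero, Finset.eq_empty_iff_forall_notMem]
      intro r hr
      refine hworse (Sum.inl r) ((mem_residents_iff hs).2 (by simpa [realAt] using hr)) ?_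
      exact Nat.lt_succ_self d.2.1.val
    have hown : (ownDummies M' d.1 (d.2.1.val + 1)).card = 0 := by
      rw [Finset.card_eq_zero, Finset.eq_empty_iff_forall_notMem]
      intro d' hd'
      simp only [ownDummies, Finset.mem_filter] at hd'
      exact hworse (Sum.inr d') ((mem_residents_iff hs).2 hd'.2.2)
        (Or.inl (hd'.2.1.2 ▸ Nat.lt_succ_self _))
    have hrisen : (risenDummies M' d.1 d.2.1.val).card < G.levelCap d.1 (d.2.1.val + 1) := by
      rw [← card_upward d.1 d.2.1.isLt]
      refine Finset.card_lt_card (Finset.ssubset_iff_of_subset ?_ |>.2 ⟨d, by simp [hu], ?_⟩)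
      · intro d' hd'
        simp only [risenDummies, Finset.mem_filter] at hd' ⊢
        exact ⟨hd'.1, hd'.2.1⟩
      · intro hd
        simp only [risenDummies, Finset.mem_filter] at hd
        obtain ⟨_, h2⟩ := hd.2.2
        rw [hn] at h2
        cases h2
    refine hb ⟨hadj, hp, Or.inl ?_⟩
    rw [card_residents_succ hM', hreal, hown, Nat.zero_add, Nat.zero_add]
    exact hrisen
  · obtain ⟨rfl, rfl | ⟨rfl, _⟩⟩ := ht.dummy hM'
    · exact Or.inl ht
    · exact Or.inr ht

theorem card_staying_add_card_risen (hM' : G.reduction.IsStable M') (h : H) {s : ℕ}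
    (hs : s < G.numLevels - 1) :
    (stayingDummies M' h s).card + (risenDummies M' h s).card = G.levelCap h (s + 1) := by
  rw [← card_upward h hs, ← Finset.card_union_of_disjoint]
  · congr 1
    ext d
    simp only [stayingDummies, risenDummies, Finset.mem_union, Finset.mem_filter, Finset.mem_univ,
      true_and]
    constructor
    · rintro (hd | hd)
      · exact hd.1
      · exact hd.1
    · rintro ⟨⟨rfl, rfl⟩, hu⟩
      exact (upward_sits hM' hu).imp (fun a => ⟨⟨⟨rfl, rfl⟩, hu⟩, a⟩) fun a => ⟨⟨⟨rfl, rfl⟩, hu⟩, a⟩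
  · refine Finset.disjoint_left.2 fun d h1 h2 => ?_
    simp only [stayingDummies, risenDummies, Finset.mem_filter] at h1 h2
    have := (h1.2.2.unique h2.2.2).2
    omega

/-- Below the top level every copy is full, since its own dummy residents rank it first. -/
theorem not_hasRoom (hM' : G.reduction.IsStable M') (h : H) {s : ℕ} (hs : s < G.numLevels - 1) :
    ¬ HasRoom M' h s := by
  rintro ⟨hs', hlt⟩
  have hall : ∀ d : G.Dummy, d.1 = h ∧ d.2.1.val = s → SitsAt M' (Sum.inr d) h s := by
    rintro d ⟨rfl, e⟩
    by_contra hd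
    exact hlt.ne (dummy_not_accepted hM' hs' e.symm hd).1
  have hle : G.levelCap h s ≤ (M'.residents (h, ⟨s, hs'⟩)).card := by
    rw [← card_dummies h hs, ← Finset.card_map Function.Embedding.inr]
    refine Finset.card_le_card fun x hx => ?_
    simp only [Finset.mem_map, Finset.mem_filter, Finset.mem_univ, true_and] at hx
    obtain ⟨d, hd, rfl⟩ := hx
    exact (mem_residents_iff hs').2 (hall d hd)
  omega

theorem card_zero (hM' : G.reduction.IsStable M') (h : H) :
    (realAt M' h 0).card + (ownDummies M' h 0).card = G.cap h := by
  have h0 : 0 < G.numLevels := by unfold numLevels; omega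
  have h1 : 0 < G.numLevels - 1 := by unfold numLevels; omega
  rw [← card_residents_zero hM' h h0]
  refine le_antisymm (hM'.1.2 (h, ⟨0, h0⟩)) (not_lt.1 fun hlt => ?_)
  exact not_hasRoom hM' h h1 ⟨h0, hlt⟩

/-- The positions of `h^{s+1}` not taken by risen dummy residents are as many as the dummy residents
that stay at `h^s`. -/
theorem card_succ_le (hM' : G.reduction.IsStable M') (h : H) {s : ℕ} (hs : s + 1 < G.numLevels) :
    (realAt M' h (s + 1)).card + (ownDummies M' h (s + 1)).card ≤ (stayingDummies M' h s).card := by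
  have e1 := card_staying_add_card_risen hM' h (s := s) (by omega)
  have e2 := card_residents_succ hM' h hs
  have e3 : (M'.residents (h, ⟨s + 1, hs⟩)).card ≤ G.levelCap h (s + 1) :=
    hM'.1.2 (h, ⟨s + 1, hs⟩)
  omega

theorem card_succ_eq (hM' : G.reduction.IsStable M') (h : H) {s : ℕ} (hs : s + 1 < G.numLevels)
    (hr : ¬ HasRoom M' h (s + 1)) :
    (realAt M' h (s + 1)).card + (ownDummies M' h (s + 1)).card = (stayingDummies M' h s).card := by
  have e1 := card_staying_add_card_risen hM' h (s := s) (by omega)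
  have e2 := card_residents_succ hM' h hs
  have e3 : (M'.residents (h, ⟨s + 1, hs⟩)).card ≤ G.levelCap h (s + 1) :=
    hM'.1.2 (h, ⟨s + 1, hs⟩)
  have e4 : ¬ (M'.residents (h, ⟨s + 1, hs⟩)).card < G.levelCap h (s + 1) := fun h' => hr ⟨hs, h'⟩
  omega

omit [Fintype R] in
theorem staying_subset_own (h : H) (s : ℕ) : stayingDummies M' h s ⊆ ownDummies M' h s := by
  intro d hd
  simp only [stayingDummies, ownDummies, Finset.mem_filter] at hd ⊢
  exact ⟨hd.1, hd.2.1.1, hd.2.2⟩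

omit [Fintype R] in
theorem staying_eq_own (h : H) {s : ℕ} (hs : s ≠ 1) : stayingDummies M' h s = ownDummies M' h s := by
  refine (staying_subset_own h s).antisymm fun d hd => ?_
  simp only [stayingDummies, ownDummies, Finset.mem_filter] at hd ⊢
  exact ⟨hd.1, ⟨hd.2.1, fun e => absurd (hd.2.1.2.symm.trans e) hs⟩, hd.2.2⟩

omit [Fintype R] in
theorem own_eq_zero (h : H) {s : ℕ} (hs : G.numLevels ≤ s + 1) : ownDummies M' h s = ∅ := by
  refine Finset.filter_eq_empty_iff.2 fun d _ hd => ?_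
  have := d.2.1.isLt
  have := hd.1.2
  omega

omit [Fintype R] in
theorem card_own_one_le (h : H) :
    (ownDummies M' h 1).card ≤ (stayingDummies M' h 1).card + (G.cap h - G.lower h) := by
  refine le_trans ?_ (Nat.add_le_add_left (card_low (G := G) h) _)
  refine le_trans (Finset.card_le_card fun d hd => ?_) (Finset.card_union_le _ _)
  simp only [ownDummies, stayingDummies, Finset.mem_union, Finset.mem_filter] at hd ⊢
  by_cases hu : Upward d
  · exact Or.inl ⟨hd.1, ⟨hd.2.1, hu⟩, hd.2.2⟩
  · exact Or.inr ⟨hd.1, hd.2.1, hu⟩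

/-- `h^1` ranks the dummy residents adjacent to it alone above the upward ones, so it holds all of
them as soon as it holds an upward one. -/
theorem le_card_own_one (hM' : G.reduction.IsStable M') (h : H)
    (hne : (stayingDummies M' h 1).Nonempty) :
    (stayingDummies M' h 1).card + (G.cap h - G.lower h) ≤ (ownDummies M' h 1).card := by
  obtain ⟨d, hd⟩ := hne
  simp only [stayingDummies, Finset.mem_filter] at hd
  obtain ⟨_, ⟨⟨hd1, hd2⟩, hu⟩, hsit⟩ := hd
  have hlev : 1 < G.numLevels - 1 := hd2.symm.trans_lt d.2.1.isLt
  have e := Finset.card_filter_add_card_filter_not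
    (s := Finset.univ.filter fun d : G.Dummy => d.1 = h ∧ d.2.1.val = 1) Upward
  rw [Finset.filter_filter, Finset.filter_filter, card_upward h hlev, card_dummies h hlev] at e
  simp only [levelCap, le_refl, if_true] at e
  rw [if_neg (by omega)] at e
  have e2 : G.cap h - G.lower h =
      (Finset.univ.filter fun d : G.Dummy => (d.1 = h ∧ d.2.1.val = 1) ∧ ¬ Upward d).card := by
    omega
  rw [e2, ← Finset.card_union_of_disjoint]
  · refine Finset.card_le_card fun d' hd' => ?_
    rcases Finset.mem_union.1 hd' with hd' | hd'
    · exact staying_subset_own h 1 hd'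
    · simp only [ownDummies, Finset.mem_filter] at hd' ⊢
      obtain ⟨_, ⟨h1, h2⟩, hnu⟩ := hd'
      refine ⟨Finset.mem_univ _, ⟨h1, h2⟩, ?_⟩
      by_contra hns
      subst h1
      have h3 := (dummy_not_accepted hM' (s := 1) (by omega) h2.symm hns).2 d hsit hd2
      have h4 := hu hd2
      have h5 : G.cap d'.1 - G.lower d'.1 = G.cap d.1 - G.lower d.1 := by rw [hd1]
      exact hnu fun _ => (h5.le.trans h4).trans h3
  · refine Finset.disjoint_left.2 fun d h1 h2 => ?_
    simp only [stayingDummies, Finset.mem_filter] at h1 h2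
    exact h2.2.2 h1.2.1.2

end Counting

end HRLQInstance

/-! ### Levels and quotas -/

namespace HRLQInstance

section Quotas

open Classical

variable {R H : Type*} [Fintype H] {G : HRLQInstance R H}
  {M' : Assignment G.AllRes G.CopyHosp}

/-- The level of the copy to which `M'` assigns `r`, and `0` if `r` is unmatched. -/
def level (M' : Assignment G.AllRes G.CopyHosp) (r : R) : ℕ :=
  (M' (Sum.inl r)).elim 0 fun p => p.2.val

theorem SitsAt.level {r : R} {h : H} {s : ℕ} (a : SitsAt M' (Sum.inl r) h s) : level M' r = s := by
  obtain ⟨hs, a⟩ := a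
  simp [HRLQInstance.level, a]

theorem SitsAt.mapMatching {r : R} {h : H} {s : ℕ} (a : SitsAt M' (Sum.inl r) h s) :
    G.mapMatching M' r = some h := by
  obtain ⟨hs, a⟩ := a
  simp [HRLQInstance.mapMatching, a]

theorem sitsAt_level {r : R} {h : H} (a : G.mapMatching M' r = some h) :
    SitsAt M' (Sum.inl r) h (level M' r) := by
  rcases sitsAt_cases M' (Sum.inl r) with hn | ⟨h', s, hs⟩
  · simp [HRLQInstance.mapMatching, hn] at a
  · rw [hs.mapMatching] at a
    obtain rfl : h' = h := by simpa using a
    rw [hs.level]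
    exact hs

theorem level_eq_zero {r : R} (a : G.mapMatching M' r = none) : level M' r = 0 := by
  rcases sitsAt_cases M' (Sum.inl r) with hn | ⟨h', s, hs⟩
  · simp [HRLQInstance.level, hn]
  · rw [hs.mapMatching] at a
    cases a

theorem level_lt {r : R} : level M' r < G.numLevels := by
  rcases sitsAt_cases M' (Sum.inl r) with hn | ⟨h', s, hs⟩
  · simp [HRLQInstance.level, hn, numLevels]
  · rw [hs.level]
    exact hs.1

variable [Fintype R]

/-- The residents of `G` that `M'` assigns to copies of `h` of level at least `2`. -/
noncomputable def highAt (M' : Assignment G.AllRes G.CopyHosp) (h : H) : Finset R :=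
  ((G.mapMatching M').residents h).filter fun r => 2 ≤ level M' r

theorem filter_level_residents (h : H) (s : ℕ) :
    (((G.mapMatching M').residents h).filter fun r => level M' r = s) = realAt M' h s := by
  ext r
  simp only [Finset.mem_filter, Assignment.mem_residents, realAt, Finset.mem_univ, true_and]
  refine ⟨fun ⟨a, b⟩ => b ▸ sitsAt_level a, fun a => ⟨a.mapMatching, a.level⟩⟩

theorem card_highAt (h : H) :
    (highAt M' h).card = ∑ s ∈ Finset.Ico 2 G.numLevels, (realAt M' h s).card := by
  rw [Finset.card_eq_sum_card_fiberwise (f := level M') (t := Finset.Ico 2 G.numLevels)]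
  · refine Finset.sum_congr rfl fun s hs => ?_
    rw [← filter_level_residents, highAt, Finset.filter_filter]
    congr 1
    refine Finset.filter_congr fun r _ => ?_
    have := (Finset.mem_Ico.1 hs).1
    constructor
    · exact fun a => a.2
    · exact fun a => ⟨a ▸ this, a⟩
  · intro r hr
    simp only [highAt, Finset.coe_filter, Set.mem_ofPred_eq] at hr
    simp only [Finset.coe_Ico, Set.mem_Ico]
    exact ⟨hr.2, level_lt⟩

theorem card_residents_map (h : H) :
    ((G.mapMatching M').residents h).card =
      (realAt M' h 0).card + (realAt M' h 1).card + (highAt M' h).card := by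
  rw [card_highAt, Finset.card_eq_sum_card_fiberwise (f := level M') (t := Finset.range G.numLevels)]
  · have hn : 2 ≤ G.numLevels := Nat.le_add_right 2 _
    simp only [filter_level_residents]
    rw [Finset.range_eq_Ico, ← Finset.sum_Ico_consecutive _ (Nat.zero_le 2)
      hn]
    simp [Finset.sum_Ico_eq_sum_range, Finset.sum_range_succ]
  · intro r _
    simpa using level_lt

/-- Only an upward dummy resident staying at `h^1` makes room on the copies above level `1`. -/
theorem card_highAt_le (hM' : G.reduction.IsStable M') (h : H) :
    (highAt M' h).card ≤ (stayingDummies M' h 1).card := by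
  have key : ∀ s, 1 ≤ s → s < G.numLevels →
      ∑ t ∈ Finset.Ico 2 (s + 1), (realAt M' h t).card + (stayingDummies M' h s).card ≤
        (stayingDummies M' h 1).card := by
    intro s hs
    induction s, hs using Nat.le_induction with
    | base => simp
    | succ s hs ih =>
      intro hl
      have h1 := ih (by omega)
      have h2 := card_succ_le hM' h hl
      have h3 := Finset.card_le_card (staying_subset_own (M' := M') h (s + 1))
      rw [Finset.sum_Ico_succ_top (by omega)]
      omega
  have hn : 2 ≤ G.numLevels := Nat.le_add_right 2 _
  have := key (G.numLevels - 1) (by omega) (by omega)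
  rw [card_highAt]
  rw [Nat.sub_add_cancel (by omega)] at this
  omega

/-- If the top copy is full as well, all copies are, and the count is exact. -/
theorem card_highAt_eq (hM' : G.reduction.IsStable M') (h : H)
    (hr : ¬ HasRoom M' h (G.numLevels - 1)) :
    (highAt M' h).card = (stayingDummies M' h 1).card := by
  have key : ∀ s, 1 ≤ s → s < G.numLevels →
      ∑ t ∈ Finset.Ico 2 (s + 1), (realAt M' h t).card + (stayingDummies M' h s).card =
        (stayingDummies M' h 1).card := by
    intro s hs
    induction s, hs using Nat.le_induction with
    | base => simp
    | succ s hs ih =>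
      intro hl
      have h1 := ih (by omega)
      have hr' : ¬ HasRoom M' h (s + 1) := by
        rcases Nat.lt_or_ge (s + 1) (G.numLevels - 1) with hlt | hge
        · exact not_hasRoom hM' h hlt
        · rwa [show s + 1 = G.numLevels - 1 by omega]
      have h2 := card_succ_eq hM' h hl hr'
      rw [← staying_eq_own h (by omega)] at h2
      rw [Finset.sum_Ico_succ_top (by omega)]
      omega
  have hn : 2 ≤ G.numLevels := Nat.le_add_right 2 _
  have h1 := key (G.numLevels - 1) (by omega) (by omega)
  rw [card_highAt]
  rw [Nat.sub_add_cancel (by omega)] at h1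
  have h2 := Finset.card_le_card (staying_subset_own (M' := M') h (G.numLevels - 1))
  -- With two levels only there is no level-`1` dummy resident at all.
  by_cases h3 : G.numLevels = 2
  · simp [h3] at h1 ⊢
    have h4 := own_eq_zero (M' := M') h (s := 1) (by omega)
    have h5 := staying_subset_own (M' := M') h 1
    rw [h4] at h5
    rw [Finset.subset_empty.1 h5, Finset.card_empty]
  · rw [own_eq_zero h (by omega), Finset.card_empty] at h2
    omega

theorem card_staying_one_le (hM' : G.reduction.IsStable M') (h : H) :
    (stayingDummies M' h 1).card ≤ G.lower h := by
  by_cases hs : 1 < G.numLevels - 1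
  · have e1 := card_staying_add_card_risen hM' h hs
    simp only [levelCap] at e1
    rw [if_neg (by omega)] at e1
    omega
  · have h1 := Finset.card_le_card (staying_subset_own (M' := M') h 1)
    rw [own_eq_zero h (by omega), Finset.card_empty] at h1
    omega

theorem card_low_levels_le (hM' : G.reduction.IsStable M') (h : H) :
    (realAt M' h 0).card + (realAt M' h 1).card + (ownDummies M' h 1).card ≤ G.cap h := by
  have h1 := card_zero hM' h
  have h2 := card_succ_le hM' h (s := 0) (by unfold numLevels; omega)
  rw [staying_eq_own h (by omega), zero_add] at h2
  omega

theorem card_low_levels_eq (hM' : G.reduction.IsStable M') (h : H) (hr : ¬ HasRoom M' h 1) :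
    (realAt M' h 0).card + (realAt M' h 1).card + (ownDummies M' h 1).card = G.cap h := by
  have h1 := card_zero hM' h
  have h2 := card_succ_eq hM' h (s := 0) (by unfold numLevels; omega) hr
  rw [staying_eq_own h (by omega), zero_add] at h2
  omega

theorem isMatching_mapMatching (hM' : G.reduction.IsStable M') :
    G.toHRInstance.IsMatching (G.mapMatching M') := by
  refine ⟨fun r h a => (sitsAt_level a).adj hM', fun h => ?_⟩
  have h1 := card_low_levels_le hM' h
  have h2 := card_highAt_le hM' h
  have h3 := Finset.card_le_card (staying_subset_own (M' := M') h 1)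
  rw [card_residents_map]
  omega

/-- A hospital with a resident above level `1` is filled to its lower quota at most. -/
theorem card_le_lower (hM' : G.reduction.IsStable M') {h : H} {r : R}
    (a : G.mapMatching M' r = some h) (hl : 2 ≤ level M' r) :
    ((G.mapMatching M').residents h).card ≤ G.lower h := by
  have hpos : 0 < (highAt M' h).card :=
    Finset.card_pos.2 ⟨r, by simp [highAt, Assignment.mem_residents, a, hl]⟩
  have h1 := card_low_levels_le hM' h
  have h2 := card_highAt_le hM' h
  have h3 := le_card_own_one hM' h (Finset.card_pos.1 (by omega))
  have h4 := G.lower_le_cap h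
  rw [card_residents_map]
  omega

theorem card_highAt_le_lower (hM' : G.reduction.IsStable M') (h : H) :
    (highAt M' h).card ≤ G.lower h :=
  (card_highAt_le hM' h).trans (card_staying_one_le hM' h)

theorem card_highAt_lt_lower {h : H}
    (hd : ((G.mapMatching M').residents h).card < G.lower h) : (highAt M' h).card < G.lower h :=
  (Finset.card_le_card (Finset.filter_subset _ _)).trans_lt hd

theorem isOpen_one (hM' : G.reduction.IsStable M') {h : H}
    (hd : ((G.mapMatching M').residents h).card < G.cap h) : IsOpen M' h 1 := by
  by_contra hc
  obtain ⟨h1, h2⟩ := not_or.1 hc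
  have h3 := card_low_levels_eq hM' h h1
  rw [Finset.not_nonempty_iff_eq_empty.1 h2, Finset.card_empty] at h3
  rw [card_residents_map] at hd
  omega

/-- If `h` misses its lower quota, its top copy has a free position. -/
theorem isOpen_top (hM' : G.reduction.IsStable M') {h : H}
    (hd : ((G.mapMatching M').residents h).card < G.lower h) : IsOpen M' h (G.numLevels - 1) := by
  by_contra hc
  obtain ⟨h1, -⟩ := not_or.1 hc
  have hq : G.lower h ≤ ∑ h, G.lower h := Finset.single_le_sum (fun _ _ => Nat.zero_le _)
    (Finset.mem_univ h)
  have h2 : ¬ HasRoom M' h 1 := not_hasRoom hM' h (by unfold numLevels; omega)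
  have h3 := card_low_levels_eq hM' h h2
  have h4 := card_highAt_eq hM' h h1
  have h5 := card_own_one_le (M' := M') h
  have h6 := G.lower_le_cap h
  rw [card_residents_map] at hd
  omega

/-- If `h^{s+1}` holds a resident of `G`, not all dummy residents of level `s` have risen to it, so
one of them sits at `h^s`. -/
theorem isOpen_of_sitsAt_succ (hM' : G.reduction.IsStable M') {h : H} {s : ℕ} {r : R}
    (a : SitsAt M' (Sum.inl r) h (s + 1)) : IsOpen M' h s := by
  have h1 := card_succ_le hM' h a.1
  have h2 : 0 < (realAt M' h (s + 1)).card := Finset.card_pos.2 ⟨r, by simpa [realAt] using a⟩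
  obtain ⟨d, hd⟩ := Finset.card_pos.1 (show 0 < (stayingDummies M' h s).card by omega)
  exact Or.inr ⟨d, staying_subset_own h s hd⟩

/-! ### Feasibility -/

/-- Fewer residents than there are levels from `2` upwards sit on those levels, so one of these
levels is empty. The hospitals with residents above it, together with the deficient ones, can only
draw residents from above it, and there are too few of those to meet their lower quotas. -/
theorem isFeasible_mapMatching (hM' : G.reduction.IsStable M') {N : Assignment R H}
    (hN : G.IsFeasible N) : G.IsFeasible (G.mapMatching M') := by
  refine ⟨isMatching_mapMatching hM', ?_⟩
  by_contra hc
  push Not at hc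
  obtain ⟨h₀, hd₀⟩ := hc
  have hhigh : ∀ T : Finset H, h₀ ∈ T → ∑ h ∈ T, (highAt M' h).card < ∑ h ∈ T, G.lower h :=
    fun T hT => Finset.sum_lt_sum (fun h _ => card_highAt_le_lower hM' h)
      ⟨h₀, hT, card_highAt_lt_lower hd₀⟩
  obtain ⟨s, hs, hempty⟩ : ∃ s ∈ Finset.Ico 2 G.numLevels, ∀ r, level M' r ≠ s := by
    by_contra hall
    push Not at hall
    have hsub : Finset.Ico 2 G.numLevels ⊆
        (Finset.univ.biUnion (highAt M')).image (level M') := by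
      intro s hs
      obtain ⟨r, hr⟩ := hall s hs
      have h2 := (Finset.mem_Ico.1 hs).1
      rcases hm : G.mapMatching M' r with _ | h
      · have := level_eq_zero hm
        omega
      · refine Finset.mem_image.2 ⟨r, Finset.mem_biUnion.2 ⟨h, Finset.mem_univ _, ?_⟩, hr⟩
        simp [highAt, Assignment.mem_residents, hm, hr, h2]
    have h1 := (Finset.card_le_card hsub).trans
      (Finset.card_image_le.trans Finset.card_biUnion_le)
    have h2 := hhigh Finset.univ (Finset.mem_univ _)
    rw [Nat.card_Ico] at h1
    unfold numLevels at h1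
    omega
  obtain ⟨hs2, hsl⟩ := Finset.mem_Ico.1 hs
  set T : Finset H := Finset.univ.filter fun h =>
    ((G.mapMatching M').residents h).card < G.lower h ∨
      ∃ r, G.mapMatching M' r = some h ∧ s < level M' r with hT
  -- Every neighbour of a hospital in `T` has level at least `s`, and level `s` is empty.
  have hN1 : T.biUnion N.residents ⊆ T.biUnion (highAt M') := by
    intro r hr
    obtain ⟨h, hh, hr⟩ := Finset.mem_biUnion.1 hr
    have hadj : G.adj r h := hN.1.1 r h (Assignment.mem_residents.1 hr)
    obtain ⟨h', t, ht, hst⟩ : ∃ h' t, SitsAt M' (Sum.inl r) h' t ∧ s ≤ t := by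
      rcases (Finset.mem_filter.1 hh).2 with hd | ⟨y, hy, hly⟩
      · obtain ⟨h', t, ht, h1⟩ := (isOpen_top hM' hd).level_ge hM' hadj
        exact ⟨h', t, ht, by omega⟩
      · have hy' := sitsAt_level hy
        obtain ⟨k, hk⟩ : ∃ k, level M' y = k + 1 := ⟨level M' y - 1, by omega⟩
        rw [hk] at hy'
        obtain ⟨h', t, ht, h1⟩ := (isOpen_of_sitsAt_succ hM' hy').level_ge hM' hadj
        exact ⟨h', t, ht, by omega⟩
    have hlev : s < level M' r := by
      have h1 := hempty r
      rw [ht.level] at h1 ⊢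
      omega
    refine Finset.mem_biUnion.2 ⟨h', ?_, ?_⟩
    · exact Finset.mem_filter.2 ⟨Finset.mem_univ _, Or.inr ⟨r, ht.mapMatching, hlev⟩⟩
    · simp only [highAt, Finset.mem_filter, Assignment.mem_residents]
      exact ⟨ht.mapMatching, by omega⟩
  have hN2 : ∑ h ∈ T, (N.residents h).card = (T.biUnion N.residents).card := by
    refine (Finset.card_biUnion fun h₁ _ h₂ _ hne => Finset.disjoint_left.2 fun r a b => hne ?_).symm
    have := (Assignment.mem_residents.1 a).symm.trans (Assignment.mem_residents.1 b)
    simpa using this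
  have h1 := (Finset.card_le_card hN1).trans Finset.card_biUnion_le
  have h2 := hhigh T (Finset.mem_filter.2 ⟨Finset.mem_univ _, Or.inl hd₀⟩)
  have h3 := Finset.sum_le_sum fun h (_ : h ∈ T) => hN.2 h
  omega

end Quotas

end HRLQInstance

/-! ### Votes and pairings -/

section Votes

open Classical

theorem vote_le_one {α : Type*} (pref : α → α → Prop) (x y : Option α) : vote pref x y ≤ 1 := by
  unfold vote
  split_ifs <;> norm_num

theorem vote_eq_neg_one {α : Type*} {pref : α → α → Prop} {x y : Option α}
    (h₁ : ¬ optPref pref x y) (h₂ : optPref pref y x) : vote pref x y = -1 := by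
  rw [vote, if_neg h₁, if_pos h₂]

theorem vote_comm {α : Type*} {pref : α → α → Prop} {x y : Option α}
    (h : ¬ (optPref pref x y ∧ optPref pref y x)) : vote pref x y = -vote pref y x := by
  unfold vote
  split_ifs <;> first | rfl | tauto

/-- A potential bound on the pairs of a pairing bounds their sum. A pair with `⊥` occurs only on
the larger side, which is what the cardinality hypotheses record. -/
theorem Pairing.sum_le {R : Type*} {A B : Finset R} (c : Pairing A B)
    (w : Option R → Option R → ℤ) (F K : R → ℤ)
    (h₁ : ∀ a ∈ A, ∀ b ∈ B, w (some a) (some b) ≤ F a - K b)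
    (h₂ : B.card < A.card → ∀ a ∈ A, w (some a) none ≤ F a)
    (h₃ : A.card < B.card → ∀ b ∈ B, w none (some b) ≤ -K b) :
    (∑ r ∈ A, w (some r) (c.corr r)) +
      ∑ r' ∈ B.filter (fun r' => ∀ r ∈ A, c.corr r ≠ some r'), w none (some r') ≤
      ∑ a ∈ A, F a - ∑ b ∈ B, K b := by
  have hA : ∀ a ∈ A, w (some a) (c.corr a) ≤ F a - (c.corr a).elim 0 K := by
    intro a ha
    rcases hc : c.corr a with _ | b
    · have hsub : B.card < A.card := by
        rw [← Finset.card_erase_add_one ha, Nat.lt_succ_iff]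
        refine Finset.card_le_card_of_forall_subsingleton (fun b r => c.corr r = some b) ?_ ?_
        · intro b hb
          obtain ⟨r, hr, hrb⟩ := c.corr_max a ha hc b hb
          refine ⟨r, Finset.mem_erase.2 ⟨?_, hr⟩, hrb⟩
          rintro rfl
          rw [hc] at hrb
          cases hrb
        · intro r _ b₁ hb₁ b₂ hb₂
          exact Option.some_injective _ (hb₁.2.symm.trans hb₂.2)
      simpa using h₂ hsub a ha
    · exact h₁ a ha b (c.corr_mem a ha b hc)
  -- An unpaired `b` leaves no room for a `⊥` opposite `A`, so `A` injects into `B` without `b`.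
  have hB : ∀ b ∈ B.filter (fun r' => ∀ r ∈ A, c.corr r ≠ some r'),
      w none (some b) ≤ -K b := by
    intro b hb
    obtain ⟨hb, hun⟩ := Finset.mem_filter.1 hb
    refine h₃ ?_ b hb
    rw [← Finset.card_erase_add_one hb, Nat.lt_succ_iff]
    refine Finset.card_le_card_of_forall_subsingleton (fun r b => c.corr r = some b) ?_ ?_
    · intro a ha
      rcases hc : c.corr a with _ | b'
      · obtain ⟨r, hr, hrb⟩ := c.corr_max a ha hc b hb
        exact absurd hrb (hun r hr)
      · refine ⟨b', Finset.mem_erase.2 ⟨?_, c.corr_mem a ha b' hc⟩, rfl⟩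
        rintro rfl
        exact hun a ha hc
    · intro b' _ r₁ hr₁ r₂ hr₂
      exact c.corr_inj r₁ hr₁.1 r₂ hr₂.1 b' hr₁.2 hr₂.2
  have hK : ∑ a ∈ A, (c.corr a).elim 0 K =
      ∑ b ∈ B.filter (fun r' => ¬ ∀ r ∈ A, c.corr r ≠ some r'), K b := by
    have e1 : ∀ a ∈ A, (c.corr a).elim 0 K = ∑ b ∈ B, if c.corr a = some b then K b else 0 := by
      intro a ha
      rcases hc : c.corr a with _ | b
      · simp
      · simp [c.corr_mem a ha b hc]
    rw [Finset.sum_congr rfl e1, Finset.sum_comm, Finset.sum_filter]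
    refine Finset.sum_congr rfl fun b _ => ?_
    by_cases hb : ∀ r ∈ A, c.corr r ≠ some b
    · rw [if_neg (not_not.2 hb)]
      exact Finset.sum_eq_zero fun r hr => if_neg (hb r hr)
    · rw [if_pos hb]
      push Not at hb
      obtain ⟨r, hr, hrb⟩ := hb
      rw [Finset.sum_eq_single_of_mem r hr, if_pos hrb]
      intro r' hr' hne
      exact if_neg fun e => hne (c.corr_inj r' hr' r hr b e hrb)
  have e2 := Finset.sum_filter_add_sum_filter_not B (fun r' => ∀ r ∈ A, c.corr r ≠ some r') K
  have e3 := Finset.sum_le_sum hA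
  have e4 := Finset.sum_le_sum hB
  rw [Finset.sum_sub_distrib] at e3
  rw [Finset.sum_neg_distrib] at e4
  linarith

/-- Summing over the residents that each hospital gains in passing from `M` to `N`. -/
theorem Assignment.sum_residents_sdiff {R H : Type*} [Fintype R] [Fintype H]
    (N M : Assignment R H) (g : R → ℤ) :
    ∑ h, ∑ r ∈ N.residents h \ M.residents h, g r =
      ∑ r, if N r ≠ M r ∧ N r ≠ none then g r else 0 := by
  have e : ∀ h, ∑ r ∈ N.residents h \ M.residents h, g r =
      ∑ r, if N r = some h ∧ M r ≠ some h then g r else 0 := by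
    intro h
    rw [← Finset.sum_filter]
    refine Finset.sum_congr ?_ fun _ _ => rfl
    ext r
    simp [Assignment.mem_residents]
  simp only [e]
  rw [Finset.sum_comm]
  refine Finset.sum_congr rfl fun r _ => ?_
  rcases hN : N r with _ | h
  · simp
  · rw [Finset.sum_eq_single_of_mem h (Finset.mem_univ _)]
    · simp [eq_comm]
    · intro h' _ hne
      exact if_neg fun a => hne (Option.some_injective _ a.1).symm

theorem Assignment.card_sdiff_lt_iff {R H : Type*} [Fintype R] {N M : Assignment R H} {h : H} :
    (N.residents h \ M.residents h).card < (M.residents h \ N.residents h).card ↔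
      (N.residents h).card < (M.residents h).card := by
  have h₁ := Finset.card_sdiff_add_card_inter (N.residents h) (M.residents h)
  have h₂ := Finset.card_sdiff_add_card_inter (M.residents h) (N.residents h)
  rw [Finset.inter_comm] at h₂
  omega

/-- A larger matching matches a resident that `M` leaves unmatched. -/
theorem Assignment.card_only_pos {R H : Type*} [Fintype R] {M N : Assignment R H}
    (hlt : M.size < N.size) :
    0 < (Finset.univ.filter fun r => M r = none ∧ N r ≠ none).card := by
  rw [Finset.card_pos]
  by_contra hne
  refine absurd (Finset.card_le_card fun r hr => ?_) (not_le.2 hlt)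
  simp only [Finset.mem_filter, Finset.mem_univ, true_and] at hr ⊢
  exact fun hm => hne ⟨r, by simp [hm, hr]⟩

end Votes

namespace HRInstance

variable {R H : Type*} {G : HRInstance R H}

theorem vote_prefR_comm {r : R} {x y : Option H} (hx : ∀ h, x = some h → G.adj r h)
    (hy : ∀ h, y = some h → G.adj r h) : vote (G.prefR r) x y = -vote (G.prefR r) y x := by
  refine vote_comm ?_
  rintro ⟨h₁, h₂⟩
  rcases x with _ | x
  · exact h₁
  rcases y with _ | y
  · exact h₂
  exact G.prefR_irrefl r x (hx x rfl) (G.prefR_trans r x y x (hx x rfl) (hy y rfl) (hx x rfl) h₁ h₂)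

theorem vote_prefH_comm {h : H} {x y : R} (hx : G.adj x h) (hy : G.adj y h) :
    vote (G.prefH h) (some x) (some y) = -vote (G.prefH h) (some y) (some x) :=
  vote_comm fun ⟨h₁, h₂⟩ => G.prefH_irrefl h x hx (G.prefH_trans h x y x hx hy hx h₁ h₂)

theorem vote_prefR_eq_neg_one {x : R} {h h' : H} (hx : G.adj x h) (hx' : G.adj x h')
    (hp : G.prefR x h' h) : vote (G.prefR x) (some h) (some h') = -1 :=
  vote_eq_neg_one (fun hp' : G.prefR x h h' => G.prefR_irrefl x h hx
    (G.prefR_trans x h h' h hx hx' hx hp' hp)) hp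

end HRInstance

namespace HRLQInstance

/-! ### Popularity -/

section Popularity

open Classical

variable {R H : Type*} [Fintype H] [Fintype R] {G : HRLQInstance R H}
  {M' : Assignment G.AllRes G.CopyHosp}

/-- If `x` would like to join `h^s`, then `h` prefers every resident that `h^s` holds. -/
theorem vote_prefH_eq_neg_one (hM' : G.reduction.IsStable M') {x y : R} {h : H} {s : ℕ}
    (hx : G.adj x h) (hy : SitsAt M' (Sum.inl y) h s) (hne : x ≠ y)
    (hlike : ∀ h' t, SitsAt M' (Sum.inl x) h' t → t < s ∨ (s = t ∧ G.prefR x h h')) :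
    vote (G.prefH h) (some x) (some y) = -1 := by
  have hno : ¬ G.prefH h x y := by
    intro hp
    refine hM'.2 (Sum.inl x) (h, ⟨s, hy.1⟩) ⟨hx, ?_, Or.inr ⟨Sum.inl y, ?_, hp⟩⟩
    · rcases hm : M' (Sum.inl x) with _ | ⟨h', t⟩
      · trivial
      · exact (hlike h' t.val ⟨t.isLt, hm⟩).imp id fun a => ⟨Fin.ext a.1, a.2⟩
    · exact (mem_residents_iff hy.1).2 hy
  exact vote_eq_neg_one hno ((G.prefH_total h x y hx (hy.adj hM') hne).resolve_left hno)

/-- The votes of a resident `x` whom `h` gains and of `h` between `x` and a resident `y` whom it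
loses are bounded by twice the difference of levels. -/
theorem vote_add_vote_le (hM' : G.reduction.IsStable M') {x y : R} {h : H} (hx : G.adj x h)
    (hxh : G.mapMatching M' x ≠ some h) (hy : G.mapMatching M' y = some h) :
    vote (G.prefR x) (some h) (G.mapMatching M' x) + vote (G.prefH h) (some x) (some y) ≤
      2 * (level M' x : ℤ) - 2 * (level M' y : ℤ) := by
  have hne : x ≠ y := by
    rintro rfl
    exact hxh hy
  have hsy := sitsAt_level hy
  have b₁ := vote_le_one (G.prefR x) (some h) (G.mapMatching M' x)
  have b₂ := vote_le_one (G.prefH h) (some x) (some y)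
  have hopen : ∀ k, level M' y = k + 1 → ∃ h' t, SitsAt M' (Sum.inl x) h' t ∧
      (k < t ∨ (k = t ∧ (h' = h ∨ G.prefR x h' h))) := by
    intro k hk
    rw [hk] at hsy
    exact (isOpen_of_sitsAt_succ hM' hsy).level_ge hM' hx
  rcases hm : G.mapMatching M' x with _ | h'
  · rw [hm] at b₁
    have hno : ∀ h' t, ¬ SitsAt M' (Sum.inl x) h' t := by
      intro h' t ht
      rw [ht.mapMatching] at hm
      cases hm
    have v := vote_prefH_eq_neg_one hM' hx hsy hne fun h' t ht => absurd ht (hno h' t)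
    have h0 : level M' y = 0 := by
      rcases hk : level M' y with _ | k
      · rfl
      · obtain ⟨h', t, ht, _⟩ := hopen k hk
        exact absurd ht (hno h' t)
    rw [level_eq_zero hm, h0]
    push_cast
    linarith
  · rw [hm] at b₁
    have hsx := sitsAt_level hm
    have hh' : h' ≠ h := by
      rintro rfl
      exact hxh hm
    have hadj := hsx.adj hM'
    rcases lt_trichotomy (level M' x) (level M' y) with hlt | heq | hgt
    · have v := vote_prefH_eq_neg_one hM' hx hsy hne fun h'' t ht =>
        Or.inl (by rw [← (hsx.unique ht).2]; exact hlt)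
      obtain ⟨k, hk⟩ : ∃ k, level M' y = k + 1 := ⟨level M' y - 1, by omega⟩
      obtain ⟨h'', t, ht, hc⟩ := hopen k hk
      obtain ⟨rfl, rfl⟩ := hsx.unique ht
      have hc' : k = level M' x ∧ G.prefR x h' h := by
        rcases hc with hc | ⟨e, hc | hc⟩
        · omega
        · exact absurd hc hh'
        · exact ⟨e, hc⟩
      have v' := HRInstance.vote_prefR_eq_neg_one hx hadj hc'.2
      rw [hk, v, v', hc'.1]
      push_cast
      linarith
    · rw [heq]
      rcases G.prefR_total x h h' hx hadj hh'.symm with hp | hp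
      · have v := vote_prefH_eq_neg_one hM' hx hsy hne fun h'' t ht => by
          obtain ⟨rfl, rfl⟩ := hsx.unique ht
          exact Or.inr ⟨heq.symm, hp⟩
        linarith
      · have v := HRInstance.vote_prefR_eq_neg_one hx hadj hp
        linarith
    · have : (level M' y : ℤ) + 1 ≤ level M' x := by exact_mod_cast hgt
      linarith

/-- The vote of a resident `x` that takes an additional position of `h`. -/
theorem vote_le_of_card_lt (hM' : G.reduction.IsStable M') {x : R} {h : H} (hx : G.adj x h)
    (hxh : G.mapMatching M' x ≠ some h)
    (hd : ((G.mapMatching M').residents h).card < G.cap h) :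
    vote (G.prefR x) (some h) (G.mapMatching M' x) + 1 ≤ 2 * (level M' x : ℤ) - 1 := by
  obtain ⟨h', t, ht, hc⟩ := (isOpen_one hM' hd).level_ge hM' hx
  have b := vote_le_one (G.prefR x) (some h) (G.mapMatching M' x)
  rw [ht.mapMatching] at hxh b ⊢
  rw [ht.level]
  rcases hc with hc | ⟨rfl, rfl | hp⟩
  · have : (2 : ℤ) ≤ t := by exact_mod_cast hc
    linarith
  · exact absurd rfl hxh
  · rw [HRInstance.vote_prefR_eq_neg_one hx (ht.adj hM') hp]
    norm_num

/-- The potential of a resident, which certifies the popularity of `M`: an exchange of `y` for `x`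
is worth at most the potential of `x` minus that of `y` in votes. The summand `-1` makes the
potential `-1` on unmatched residents and at most `1` on the levels `0` and `1`. -/
def potential (M' : Assignment G.AllRes G.CopyHosp) (r : R) : ℤ := 2 * (level M' r : ℤ) - 1

/-- The bound on the votes of `h` that `potential` certifies. -/
noncomputable def hospitalBound (M' : Assignment G.AllRes G.CopyHosp) (N : Assignment R H)
    (h : H) : ℤ :=
  ∑ x ∈ N.residents h \ (G.mapMatching M').residents h,
      (potential M' x - vote (G.prefR x) (N x) (G.mapMatching M' x)) -
    ∑ y ∈ (G.mapMatching M').residents h \ N.residents h, potential M' y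

theorem paired_bound (hM' : G.reduction.IsStable M') {N : Assignment R H} (hN : G.IsFeasible N)
    {h : H} {x y : R} (hx : x ∈ N.residents h \ (G.mapMatching M').residents h)
    (hy : y ∈ (G.mapMatching M').residents h \ N.residents h) :
    vote (G.prefH h) (some x) (some y) ≤
      (potential M' x - vote (G.prefR x) (N x) (G.mapMatching M' x)) - potential M' y := by
  simp only [Finset.mem_sdiff, Assignment.mem_residents] at hx hy
  have := vote_add_vote_le hM' (hN.1.1 _ _ hx.1) hx.2 hy.1
  rw [hx.1]
  unfold potential
  linarith

theorem gained_bound (hM' : G.reduction.IsStable M') {N : Assignment R H} (hN : G.IsFeasible N)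
    {h : H} {x : R}
    (hlt : ((G.mapMatching M').residents h \ N.residents h).card <
      (N.residents h \ (G.mapMatching M').residents h).card)
    (hx : x ∈ N.residents h \ (G.mapMatching M').residents h) :
    (1 : ℤ) ≤ potential M' x - vote (G.prefR x) (N x) (G.mapMatching M' x) := by
  simp only [Finset.mem_sdiff, Assignment.mem_residents] at hx
  have := vote_le_of_card_lt hM' (hN.1.1 _ _ hx.1) hx.2
    ((Assignment.card_sdiff_lt_iff.1 hlt).trans_le (hN.1.2 h))
  rw [hx.1]
  unfold potential
  linarith

theorem lost_bound (hM' : G.reduction.IsStable M') {N : Assignment R H} (hN : G.IsFeasible N)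
    {h : H} {y : R}
    (hlt : (N.residents h \ (G.mapMatching M').residents h).card <
      ((G.mapMatching M').residents h \ N.residents h).card)
    (hy : y ∈ (G.mapMatching M').residents h \ N.residents h) :
    potential M' y ≤ 1 := by
  simp only [Finset.mem_sdiff, Assignment.mem_residents] at hy
  have h₁ : ¬ 2 ≤ level M' y := fun hl =>
    absurd (card_le_lower hM' hy.1 hl)
      (not_le.2 ((hN.2 h).trans_lt (Assignment.card_sdiff_lt_iff.1 hlt)))
  have h₂ : (level M' y : ℤ) ≤ 1 := by exact_mod_cast (by omega : level M' y ≤ 1)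
  unfold potential
  linarith

theorem votes_le (hM' : G.reduction.IsStable M') {N : Assignment R H} (hN : G.IsFeasible N) (h : H)
    (c : Pairing (N.residents h \ (G.mapMatching M').residents h)
      ((G.mapMatching M').residents h \ N.residents h)) :
    c.votes (G.prefH h) ≤ hospitalBound M' N h := by
  refine c.sum_le (vote (G.prefH h)) _ _ (fun x hx y hy => paired_bound hM' hN hx hy) ?_ ?_
  · intro hlt x hx
    exact (vote_le_one _ _ _).trans (gained_bound hM' hN hlt hx)
  · intro hlt y hy
    rw [vote_eq_neg_one (x := none) (y := some y) not_false trivial]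
    have := lost_bound hM' hN hlt hy
    linarith

/-- The hospital may pair differently when the two matchings are compared in the other order; the
same bound applies. -/
theorem neg_votes_le (hM' : G.reduction.IsStable M') {N : Assignment R H} (hN : G.IsFeasible N)
    (h : H) (c : Pairing ((G.mapMatching M').residents h \ N.residents h)
      (N.residents h \ (G.mapMatching M').residents h)) :
    -c.votes (G.prefH h) ≤ hospitalBound M' N h := by
  have key := c.sum_le (fun a b => -vote (G.prefH h) a b) (fun y => -potential M' y)
    (fun x => -(potential M' x - vote (G.prefR x) (N x) (G.mapMatching M' x))) ?_ ?_ ?_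
  · simp only [Finset.sum_neg_distrib] at key
    unfold Pairing.votes hospitalBound
    linarith
  · intro y hy x hx
    have hp := paired_bound hM' hN hx hy
    simp only [Finset.mem_sdiff, Assignment.mem_residents] at hx hy
    rw [HRInstance.vote_prefH_comm (hN.1.1 _ _ hx.1) ((sitsAt_level hy.1).adj hM')] at hp
    linarith
  · intro hlt y hy
    have := lost_bound hM' hN hlt hy
    have hv : vote (G.prefH h) (some y) none = 1 := if_pos trivial
    rw [hv]
    linarith
  · intro hlt x hx
    have := gained_bound hM' hN hlt hx
    rw [vote_eq_neg_one (x := none) (y := some x) not_false trivial]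
    linarith

/-- The certified bounds add up to at most minus the number of residents matched only by `N`. -/
theorem sum_bound_le {N : Assignment R H} (hN : G.IsFeasible N) :
    ∑ r, vote (G.prefR r) (N r) (G.mapMatching M' r) + ∑ h, hospitalBound M' N h ≤
      -((Finset.univ.filter fun r => G.mapMatching M' r = none ∧ N r ≠ none).card : ℤ) := by
  unfold hospitalBound
  rw [Finset.sum_sub_distrib, Assignment.sum_residents_sdiff, Assignment.sum_residents_sdiff,
    ← Finset.sum_sub_distrib, ← Finset.sum_add_distrib, Finset.card_filter, Nat.cast_sum,
    ← Finset.sum_neg_distrib]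
  refine Finset.sum_le_sum fun r _ => ?_
  rcases hn : N r with _ | h <;> rcases hm : G.mapMatching M' r with _ | h'
  · simp [vote, optPref]
  · rw [vote_eq_neg_one (x := none) (y := some h') not_false trivial]
    simp [potential]
  · simp [potential, level_eq_zero hm]
  · by_cases e : h = h'
    · subst e
      have hi : ¬ G.prefR r h h := G.prefR_irrefl r h (hN.1.1 r h hn)
      simp [vote, optPref, hi]
    · simp [e, Ne.symm e]

theorem Delta_le (c : VotingRule R H) (hM' : G.reduction.IsStable M') {N : Assignment R H}
    (hN : G.IsFeasible N) :
    G.Delta c N (G.mapMatching M') ≤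
      -((Finset.univ.filter fun r => G.mapMatching M' r = none ∧ N r ≠ none).card : ℤ) := by
  refine le_trans ?_ (sum_bound_le (M' := M') hN)
  unfold Delta
  gcongr with h
  exact votes_le hM' hN h _

theorem Delta_nonneg (c : VotingRule R H) (hM' : G.reduction.IsStable M') {N : Assignment R H}
    (hN : G.IsFeasible N) : 0 ≤ G.Delta c (G.mapMatching M') N := by
  have h₁ := sum_bound_le (M' := M') hN
  have h₂ : ∑ h, -(c h (G.mapMatching M') N).votes (G.prefH h) ≤ ∑ h, hospitalBound M' N h :=
    Finset.sum_le_sum fun h _ => neg_votes_le hM' hN h _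
  have h₃ : ∑ r, vote (G.prefR r) (N r) (G.mapMatching M' r) =
      ∑ r, -vote (G.prefR r) (G.mapMatching M' r) (N r) :=
    Finset.sum_congr rfl fun r _ => HRInstance.vote_prefR_comm (fun h e => hN.1.1 r h e)
      fun h e => (sitsAt_level e).adj hM'
  rw [Finset.sum_neg_distrib] at h₂ h₃
  unfold Delta
  linarith [Int.natCast_nonneg
    (Finset.univ.filter fun r => G.mapMatching M' r = none ∧ N r ≠ none).card]

theorem Delta_lt_of_size_lt (c : VotingRule R H) (hM' : G.reduction.IsStable M')
    {N : Assignment R H} (hN : G.IsFeasible N) (hlt : (G.mapMatching M').size < N.size) :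
    G.Delta c N (G.mapMatching M') < G.Delta c (G.mapMatching M') N := by
  have h₁ := Delta_le c hM' hN
  have h₂ := Delta_nonneg c hM' hN
  have h₃ : (0 : ℤ) < (Finset.univ.filter fun r => G.mapMatching M' r = none ∧ N r ≠ none).card := by
    exact_mod_cast Assignment.card_only_pos hlt
  linarith

end Popularity

end HRLQInstance

theorem mainTheorem3 {R H : Type*} [Fintype R] [Fintype H] (G : HRLQInstance R H)
    (c : VotingRule R H) (M' : Assignment G.AllRes G.CopyHosp)
    (hM' : G.reduction.IsStable M') :
    (∀ N : Assignment R H, G.IsFeasible N → (G.mapMatching M').size < N.size →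
      G.Delta c N (G.mapMatching M') < G.Delta c (G.mapMatching M') N) ∧
    ((∃ N : Assignment R H, G.IsFeasible N) →
      G.IsPopularFeasible c (G.mapMatching M') ∧
      ∀ N : Assignment R H, G.IsPopularFeasible c N → N.size ≤ (G.mapMatching M').size) := by
  refine ⟨fun N hN hlt => HRLQInstance.Delta_lt_of_size_lt c hM' hN hlt, ?_⟩
  rintro ⟨N₀, hN₀⟩
  have hfeas := HRLQInstance.isFeasible_mapMatching hM' hN₀
  refine ⟨⟨hfeas, fun N hN => not_lt.2 ?_⟩, fun N hN => not_lt.1 fun hlt => ?_⟩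
  · have h₁ := HRLQInstance.Delta_le c hM' hN
    have h₂ := HRLQInstance.Delta_nonneg c hM' hN
    linarith [Int.natCast_nonneg
      (Finset.univ.filter fun r => G.mapMatching M' r = none ∧ N r ≠ none).card]
  · exact hN.2 _ hfeas (HRLQInstance.Delta_lt_of_size_lt c hM' hN.1 hlt)
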